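/- Let $f_1,\dots,f_k$ be nonnegative, nondecreasing, convex functions on $[0,\infty)$, let $d_{ij}\ge 0$ for $i\in[n]$, $j\in[k]$, and let $\mathcal P\subseteq[0,1]^n$ be a polytope. Consider the boolean convex program $$\min\ \sum_{j\in[k]} f_j\Big(\sum_{i\in[n]} d_{ij}y_i\Big)\quad\text{over } y\in\mathcal P\cap\{0,1\}^n,$$ with optimal value $IP$, and the configuration linear program $$\min\ \sum_{j\in[k]}\sum_{S\subseteq[n]} f_j\Big(\sum_{i\in S} d_{ij}\Big)z_{jS}$$ subject to $y\in\mathcal P$, $\sum_{S}z_{jS}=1$ for all $j$, $\sum_{S\ni i}z_{jS}=y_i$ for all $i,j$, and $z_{jS}\ge 0$, with optimal value $LP$ (an infeasible program has value $\infty$). Put $$A(f)=\sup_{t>0}\mathbb E\Big[\frac{f(tP)}{f(t)}\Big]\in[0,\infty],\qquad A_q=\mathbb E[P^q],$$ where $P$ is a Poisson random variable with parameter $1$ (with $a/0=\infty$ for $a>0$ and $0/0=0$), and let $D_j=\{i: d_{ij}\ne 0\}$. Random variables $(X_i)_{i\in D}$ are negatively associated if for all disjoint $I,J\subseteq D$ and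 all nondecreasing (measurable) $g:\mathbb R^I\to\mathbb R$, $h:\mathbb R^J\to\mathbb R$ one has $\mathbb E[g(X_i,i\in I)\,h(X_j,j\in J)]\le\mathbb E[g(X_i,i\in I)]\,\mathbb E[h(X_j,j\in J)]$ whenever these expectations exist. Suppose that $R$ is a randomized rounding that assigns to each $y\in\mathcal P$ a random point $R(y)\in\mathcal P\cap\{0,1\}^n$ such that (1) $\Pr(R_i(y)=1)=y_i$ for all $i$, and (2) for every $j$ the random variables $\{R_i(y)\}_{i\in D_j}$ are independent or negatively associated. Then: (a) For every feasible solution $(y^*,z^*)$ of the linear program, $$\mathbb E\Big[\sum_{j} f_j\Big(\sum_{i} d_{ij}R_i(y^*)\Big)\Big]\le\sum_{j}A(f_j)\sum_{S\subseteq[n]}f_j\Big(\sum_{i\in S}d_{ij}\Big)z^*_{jS},$$ provided that no product on the right-hand side is of the indeterminate form $\infty\cdot 0$ (for instance, if all $A(f_j)$ are finite). (b) $LP\le IP$; and if $\varepsilon\ge0$ and $(y^*,z^*)$ is a feasible solution of the linear program of cost at most $(1+\varepsilon)LP$, then $$\mathbb E\Big[\sum_{j} f_j\Big(\sum_{i}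 d_{ij}R_i(y^*)\Big)\Big]\le(1+\varepsilon)\,\max_jA(f_j)\cdot IP,$$ provided that $\max_jA(f_j)<\infty$ or $IP\neq0$ (for $k=0$ the maximum is read as $0$). (c) If $\mathcal P\neq\emptyset$, and $\max_jA(f_j)<\infty$ or $LP\ne0$, then the integrality gap is at most $\max_jA(f_j)$, that is, $IP\le\max_jA(f_j)\cdot LP$. (d) For every $q\ge1$, $A_q<\infty$ and $A(ct^q)=A_q$ for every $c>0$. If $f_j(t)=c_jt^q$ with $c_j\ge0$ for all $j$, then the expected cost of $R(y^*)$ is at most $A_q$ times the cost of $(y^*,z^*)$ for every feasible $(y^*,z^*)$, it is at most $(1+\varepsilon)A_q\cdot IP$ for every feasible $(y^*,z^*)$ of cost at most $(1+\varepsilon)LP$ with $\varepsilon\ge0$, and $IP\le A_q\cdot LP$. -/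

import Mathlib

open MeasureTheory ProbabilityTheory
open scoped ENNReal

/-- `A(f) = sup_{t > 0} E[f(tP) / f(t)]` with `P` Poisson of parameter `1`, as an element of `[0, ∞]`
(with `a / 0 = ∞` for `a > 0` and `0 / 0 = 0`). -/
noncomputable def poissonRatio (f : ℝ → ℝ) : ℝ≥0∞ :=
  ⨆ (t : ℝ) (_ : 0 < t),
    ∫⁻ m : ℕ, ENNReal.ofReal (f (t * (m : ℝ))) / ENNReal.ofReal (f t) ∂(poissonMeasure 1)

/-- The fractional Bell number `A_q = E[P ^ q]`, the `q`-th moment of a Poisson variable of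
parameter `1`. -/
noncomputable def fractionalBell (q : ℝ) : ℝ≥0∞ :=
  ∫⁻ m : ℕ, ENNReal.ofReal ((m : ℝ) ^ q) ∂(poissonMeasure 1)

/-- Negative association: for disjoint index sets `I`, `J` and nondecreasing `f`, `g`,
`E[f(X_i, i ∈ I) g(X_j, j ∈ J)] ≤ E[f(X_i, i ∈ I)] E[g(X_j, j ∈ J)]`, required for those measurable
`f`, `g` for which the three expectations exist. -/
def NegativelyAssociated {Ω ι : Type*} [MeasurableSpace Ω] (X : ι → Ω → ℝ) (μ : Measure Ω) : Prop :=
  ∀ I J : Finset ι, Disjoint I J →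
    ∀ (f : (I → ℝ) → ℝ) (g : (J → ℝ) → ℝ), Monotone f → Monotone g → Measurable f → Measurable g →
      Integrable (fun ω => f (fun i => X i ω)) μ →
      Integrable (fun ω => g (fun j => X j ω)) μ →
      Integrable (fun ω => f (fun i => X i ω) * g (fun j => X j ω)) μ →
      ∫ ω, f (fun i => X i ω) * g (fun j => X j ω) ∂μ ≤
        (∫ ω, f (fun i => X i ω) ∂μ) * ∫ ω, g (fun j => X j ω) ∂μ

/-- An instance of the boolean convex program
`min ∑ j, f_j (∑ i, d_ij y_i)` over `y ∈ P ∩ {0,1}^n`, with `P ⊆ [0,1]^n` a polytope, `d_ij ≥ 0`, and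
every `f_j` nonnegative, nondecreasing and convex on `[0, ∞)`. -/
structure BooleanConvexProgram (n k : ℕ) where
  f : Fin k → ℝ → ℝ
  d : Fin n → Fin k → ℝ
  P : Set (Fin n → ℝ)
  f_nonneg : ∀ j t, 0 ≤ t → 0 ≤ f j t
  f_mono : ∀ j, MonotoneOn (f j) (Set.Ici 0)
  f_convex : ∀ j, ConvexOn ℝ (Set.Ici 0) (f j)
  d_nonneg : ∀ i j, 0 ≤ d i j
  P_polytope : ∃ V : Set (Fin n → ℝ), V.Finite ∧ P = convexHull ℝ V
  P_subset : P ⊆ {y | ∀ i, y i ∈ Set.Icc (0 : ℝ) 1}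

namespace BooleanConvexProgram

variable {n k : ℕ} (Q : BooleanConvexProgram n k)

/-- The integral points of the polytope, `P ∩ {0,1}^n`. -/
def integralPoints : Set (Fin n → ℝ) :=
  {y | y ∈ Q.P ∧ ∀ i, y i = 0 ∨ y i = 1}

/-- The objective of the boolean convex program. -/
noncomputable def cost (y : Fin n → ℝ) : ℝ :=
  ∑ j, Q.f j (∑ i, Q.d i j * y i)

/-- The optimal value of the boolean convex program (`∞` if it is infeasible). -/
noncomputable def ipValue : ℝ≥0∞ :=
  ⨅ y ∈ Q.integralPoints, ENNReal.ofReal (Q.cost y)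

/-- Feasibility for the configuration linear program. -/
structure LPFeasible (y : Fin n → ℝ) (z : Fin k → Finset (Fin n) → ℝ) : Prop where
  mem : y ∈ Q.P
  sum_eq_one : ∀ j, ∑ S, z j S = 1
  sum_eq : ∀ i j, ∑ S with i ∈ S, z j S = y i
  nonneg : ∀ j S, 0 ≤ z j S

/-- The `j`-th term of the objective of the configuration linear program. -/
noncomputable def lpTerm (z : Fin k → Finset (Fin n) → ℝ) (j : Fin k) : ℝ :=
  ∑ S : Finset (Fin n), Q.f j (∑ i ∈ S, Q.d i j) * z j S

/-- The objective of the configuration linear program. -/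
noncomputable def lpCost (z : Fin k → Finset (Fin n) → ℝ) : ℝ :=
  ∑ j, Q.lpTerm z j

/-- The optimal value of the configuration linear program (`∞` if it is infeasible). -/
noncomputable def lpValue : ℝ≥0∞ :=
  ⨅ (y : Fin n → ℝ) (z : Fin k → Finset (Fin n) → ℝ) (_ : Q.LPFeasible y z),
    ENNReal.ofReal (Q.lpCost z)

/-- `(y, z)` is a `(1 + ε)`-approximately optimal solution of the configuration linear program. -/
def LPApproxOptimal (ε : ℝ) (y : Fin n → ℝ) (z : Fin k → Finset (Fin n) → ℝ) : Prop :=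
  Q.LPFeasible y z ∧ ENNReal.ofReal (Q.lpCost z) ≤ ENNReal.ofReal (1 + ε) * Q.lpValue

/-- `max_j A(f_j)`. -/
noncomputable def maxRatio : ℝ≥0∞ :=
  ⨆ j, poissonRatio (Q.f j)

/-- A randomized rounding: for every `y ∈ P`, `R y` is a random point of `P ∩ {0,1}^n` with marginals
`Pr(R_i(y) = 1) = y_i` such that, for every `j`, the coordinates in `D_j = {i : d_ij ≠ 0}` are independent
or negatively associated. -/
structure IsRounding {Ω : Type*} [MeasurableSpace Ω] (μ : Measure Ω)
    (R : (Fin n → ℝ) → Ω → Fin n → ℝ) : Prop where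
  measurable : ∀ y ∈ Q.P, Measurable (R y)
  integral : ∀ y ∈ Q.P, ∀ᵐ ω ∂μ, R y ω ∈ Q.integralPoints
  marginal : ∀ y ∈ Q.P, ∀ i, μ {ω | R y ω i = 1} = ENNReal.ofReal (y i)
  dependence : ∀ y ∈ Q.P, ∀ j,
    iIndepFun (fun (i : {i : Fin n // Q.d i j ≠ 0}) ω => R y ω i) μ ∨
      NegativelyAssociated (fun (i : {i : Fin n // Q.d i j ≠ 0}) ω => R y ω i) μ

/-- The expected objective value of a random point `X`. -/
noncomputable def expectedCost {Ω : Type*} [MeasurableSpace Ω] (μ : Measure Ω)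
    (X : Ω → Fin n → ℝ) : ℝ≥0∞ :=
  ∫⁻ ω, ENNReal.ofReal (Q.cost (X ω)) ∂μ

end BooleanConvexProgram

/-! ### Convex functions on the line: increments and extension from the half-line -/

section Convex

/-! Fix `j`, and read `z_j` as the law of a random set. Draw a Poisson number `P` of independent
copies `S_1, …, S_P`, and write `a(S)` for the `d`-weight of `S`. Two comparisons bound the rounded
cost for a convex nondecreasing nonnegative `F`.

Lower end: `E F(∑ d_i X_i) ≤ E F(a(S_1) + ⋯ + a(S_P))`
(`NegativelyAssociated.integral_le_compoundPoissonMean`). The indices are added one at a time. The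
increment `h(t) = F(t + d_i) - F(t)` is nondecreasing, so negative association replaces `X_i` by its
mean `p` in `F + X_i h`. On the Poisson side, the identity `E[P g(P - 1)] = E[g(P)]` turns `p h`
into a sum over the copies containing `i`, and convexity absorbs that sum into `F`
(`compoundPoissonMean_add_le`). The dependence of the indices within one set `S` only helps.

Upper end: Jensen over the `m` copies gives `F(∑ a(S_l)) ≤ (1/m) ∑ F(m a(S_l))`, hence the bound `∑
z_S E F(a(S) P)` (`compoundPoissonMean_le`). By the definition of `A(f)` this is at most `A(f) ∑ z_S
f(a(S))`.

Summing over `j` bounds the expected cost. The gap follows because the optimum is at most the mean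
cost of a random integral point. -/

theorem ConvexOn.add_sub_mono {F : ℝ → ℝ} (hF : ConvexOn ℝ Set.univ F) {c : ℝ} (hc : 0 ≤ c) :
    Monotone fun x => F (x + c) - F x := by
  intro x y hxy
  rcases eq_or_lt_of_le hxy with rfl | hxy
  · exact le_rfl
  have hpos : 0 < y - x + c := by linarith
  -- `x + c` and `y` are convex combinations of `x` and `y + c` with interchanged weights; adding
  -- the two inequalities gives the claim.
  have h1 := hF.2 (Set.mem_univ x) (Set.mem_univ (y + c))
    (div_nonneg (sub_nonneg.2 hxy.le) hpos.le) (div_nonneg hc hpos.le) (by field_simp)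
  have h2 := hF.2 (Set.mem_univ x) (Set.mem_univ (y + c))
    (div_nonneg hc hpos.le) (div_nonneg (sub_nonneg.2 hxy.le) hpos.le)
    (by field_simp; ring)
  have e1 : ((y - x) / (y - x + c)) • x + (c / (y - x + c)) • (y + c) = x + c := by
    simp only [smul_eq_mul]; field_simp; ring
  have e2 : (c / (y - x + c)) • x + ((y - x) / (y - x + c)) • (y + c) = y := by
    simp only [smul_eq_mul]; field_simp; ring
  rw [e1] at h1
  rw [e2] at h2
  have e3 : (y - x) / (y - x + c) = 1 - c / (y - x + c) := by field_simp; ring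
  simp only [smul_eq_mul, e3] at h1 h2
  show F (x + c) - F x ≤ F (y + c) - F y
  linarith

theorem ConvexOn.add_natCast_mul_sub_le {F : ℝ → ℝ} (hF : ConvexOn ℝ Set.univ F) {c : ℝ}
    (hc : 0 ≤ c) (x : ℝ) (m : ℕ) : F x + m * (F (x + c) - F x) ≤ F (x + m * c) := by
  induction m with
  | zero => simp
  | succ m ih =>
    have h := hF.add_sub_mono hc (show x ≤ x + m * c by
      have : (0 : ℝ) ≤ m * c := by positivity
      linarith)
    have e : x + (m + 1 : ℕ) * c = x + m * c + c := by push_cast; ring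
    rw [e]
    push_cast
    simp only at h
    linarith

/-- Extending `f` to the left by the constant `f 0` keeps convexity because `f` is nondecreasing;
later arguments can then work on the whole line. -/
theorem ConvexOn.comp_max_zero {f : ℝ → ℝ} (hf : ConvexOn ℝ (Set.Ici 0) f)
    (hm : MonotoneOn f (Set.Ici 0)) : ConvexOn ℝ Set.univ fun t => f (max t 0) := by
  refine ⟨convex_univ, fun x _ y _ a b ha hb hab => ?_⟩
  have hx : (0 : ℝ) ≤ max x 0 := le_max_right _ _
  have hy : (0 : ℝ) ≤ max y 0 := le_max_right _ _
  have h0 : (0 : ℝ) ≤ a • max x 0 + b • max y 0 := by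
    simp only [smul_eq_mul]; positivity
  refine le_trans (hm (Set.mem_Ici.2 (le_max_right _ _)) h0 (max_le ?_ h0)) (hf.2 hx hy ha hb hab)
  simp only [smul_eq_mul]
  exact add_le_add (mul_le_mul_of_nonneg_left (le_max_left _ _) ha)
    (mul_le_mul_of_nonneg_left (le_max_left _ _) hb)

theorem MonotoneOn.comp_max_zero {f : ℝ → ℝ} (hm : MonotoneOn f (Set.Ici 0)) :
    Monotone fun t => f (max t 0) :=
  fun _ _ h => hm (Set.mem_Ici.2 (le_max_right _ _)) (Set.mem_Ici.2 (le_max_right _ _))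
    (max_le_max_right _ h)

end Convex

/-! ### The Poisson law of parameter 1 -/

section Poisson

theorem lintegral_poissonMeasure_one (g : ℕ → ℝ≥0∞) :
    ∫⁻ m, g m ∂(poissonMeasure 1) =
      ∑' m : ℕ, ENNReal.ofReal (Real.exp (-1) / m.factorial) * g m := by
  rw [poissonMeasure, lintegral_sum_measure]
  congr 1
  ext m
  rw [lintegral_smul_measure, lintegral_dirac]
  simp

/-- The term `m = 0` vanishes, and `m / m! = 1 / (m - 1)!` shifts the series. This size-bias
identity is what singles out the Poisson law in the comparison. -/
theorem lintegral_natCast_mul_pred_poissonMeasure_one (g : ℕ → ℝ≥0∞) :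
    ∫⁻ m, (m : ℝ≥0∞) * g (m - 1) ∂(poissonMeasure 1) = ∫⁻ m, g m ∂(poissonMeasure 1) := by
  rw [lintegral_poissonMeasure_one, lintegral_poissonMeasure_one,
    tsum_eq_zero_add' ENNReal.summable]
  simp only [Nat.cast_zero, zero_mul, mul_zero, zero_add, add_tsub_cancel_right]
  congr 1
  ext m
  rw [← mul_assoc]
  congr 1
  rw [← ENNReal.ofReal_natCast, ← ENNReal.ofReal_mul (by positivity)]
  congr 1
  rw [Nat.factorial_succ]
  push_cast
  have : (m.factorial : ℝ) ≠ 0 := by positivity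
  field_simp

theorem ae_poissonMeasure_one_iff {p : ℕ → Prop} :
    (∀ᵐ m ∂(poissonMeasure 1), p m) ↔ ∀ m, p m := by
  refine ⟨fun h m => ?_, fun h => Filter.Eventually.of_forall h⟩
  by_contra hm
  have h0 : poissonMeasure 1 {m} = 0 := measure_mono_null (fun x hx => by
    rw [Set.mem_singleton_iff.1 hx]; exact hm) h
  rw [poissonMeasure_singleton, ENNReal.ofReal_eq_zero] at h0
  exact absurd h0 (not_le.2 (by positivity))

end Poisson

/-! ### Compound Poisson sums -/

section CompoundPoisson

variable {α : Type*} [Fintype α]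

/-- `E[F(a(S_1) + ⋯ + a(S_m))]` for independent `S_l` with distribution `z`. -/
noncomputable def iidSumMean (z a : α → ℝ) (F : ℝ → ℝ) (m : ℕ) : ℝ :=
  ∑ σ : Fin m → α, (∏ l, z (σ l)) * F (∑ l, a (σ l))

/-- `E[F(a(S_1) + ⋯ + a(S_P))]` for independent `S_l` with distribution `z` and an independent
Poisson variable `P` of parameter `1`. -/
noncomputable def compoundPoissonMean (z a : α → ℝ) (F : ℝ → ℝ) : ℝ≥0∞ :=
  ∫⁻ m, ENNReal.ofReal (iidSumMean z a F m) ∂(poissonMeasure 1)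

theorem sum_pi_insertNth {β : Type*} [AddCommMonoid β] {m : ℕ} (l : Fin (m + 1))
    (G : (Fin (m + 1) → α) → β) :
    ∑ σ, G σ = ∑ S : α, ∑ τ : Fin m → α, G (l.insertNth S τ) := by
  rw [← Fintype.sum_prod_type', ← (Fin.insertNthEquiv (fun _ => α) l).sum_comp]
  rfl

theorem sum_pi_prod_eq_one {z : α → ℝ} (hz : ∑ S, z S = 1) (m : ℕ) :
    ∑ σ : Fin m → α, ∏ l, z (σ l) = 1 := by
  rw [← Fintype.sum_pow, hz, one_pow]

theorem iidSumMean_nonneg {z a : α → ℝ} {F : ℝ → ℝ} (hz : ∀ S, 0 ≤ z S) (hF : ∀ t, 0 ≤ F t)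
    (m : ℕ) : 0 ≤ iidSumMean z a F m :=
  Finset.sum_nonneg fun _ _ => mul_nonneg (Finset.prod_nonneg fun _ _ => hz _) (hF _)

/-- For each `l`, dropping `a(S_l) ≥ 0` from the argument can only decrease `h`, and makes it
independent of `b(S_l)`, so the mean factors. Summing over the `m + 1` values of `l` gives the
bound. -/
theorem mul_iidSumMean_le {z a : α → ℝ} {h : ℝ → ℝ} (hz : ∀ S, 0 ≤ z S) (ha : ∀ S, 0 ≤ a S)
    (hh : Monotone h) {b : α → ℕ} (m : ℕ) :
    (m + 1 : ℕ) * ((∑ S, z S * b S) * iidSumMean z a h m) ≤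
      ∑ σ : Fin (m + 1) → α, (∏ l, z (σ l)) * (((∑ l, b (σ l) : ℕ) : ℝ) * h (∑ l, a (σ l))) := by
  have key : ∀ l : Fin (m + 1), (∑ S, z S * b S) * iidSumMean z a h m ≤
      ∑ σ : Fin (m + 1) → α, (∏ l, z (σ l)) * ((b (σ l) : ℝ) * h (∑ l, a (σ l))) := by
    intro l
    rw [sum_pi_insertNth l, iidSumMean, Finset.sum_mul]
    refine Finset.sum_le_sum fun S _ => ?_
    rw [Finset.mul_sum]
    refine Finset.sum_le_sum fun τ _ => ?_
    rw [Fin.prod_univ_succAbove _ l, Fin.sum_univ_succAbove _ l]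
    simp only [Fin.insertNth_apply_same, Fin.insertNth_apply_succAbove]
    have h1 : h (∑ i, a (τ i)) ≤ h (a S + ∑ i, a (τ i)) := hh (by linarith [ha S])
    have h2 : 0 ≤ z S * b S * ∏ i, z (τ i) :=
      mul_nonneg (mul_nonneg (hz _) (Nat.cast_nonneg _)) (Finset.prod_nonneg fun _ _ => hz _)
    calc _ = z S * b S * (∏ i, z (τ i)) * h (∑ i, a (τ i)) := by ring
      _ ≤ z S * b S * (∏ i, z (τ i)) * h (a S + ∑ i, a (τ i)) := mul_le_mul_of_nonneg_left h1 h2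
      _ = _ := by ring
  calc _ = ∑ _l : Fin (m + 1), (∑ S, z S * b S) * iidSumMean z a h m := by simp
    _ ≤ ∑ l : Fin (m + 1), ∑ σ : Fin (m + 1) → α,
          (∏ l, z (σ l)) * ((b (σ l) : ℝ) * h (∑ l, a (σ l))) := Finset.sum_le_sum fun l _ => key l
    _ = _ := by
      rw [Finset.sum_comm]
      refine Finset.sum_congr rfl fun σ _ => ?_
      rw [← Finset.mul_sum, ← Finset.sum_mul]
      push_cast
      rfl

theorem iidSumMean_add_le {z a : α → ℝ} {F : ℝ → ℝ} (hz : ∀ S, 0 ≤ z S) (ha : ∀ S, 0 ≤ a S)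
    (hF : ConvexOn ℝ Set.univ F) {b : α → ℕ} {c : ℝ} (hc : 0 ≤ c) (m : ℕ) :
    iidSumMean z a F m +
        m * ((∑ S, z S * b S) * iidSumMean z a (fun t => F (t + c) - F t) (m - 1)) ≤
      iidSumMean z (fun S => a S + b S * c) F m := by
  have h1 : (m : ℝ) * ((∑ S, z S * b S) * iidSumMean z a (fun t => F (t + c) - F t) (m - 1)) ≤
      ∑ σ : Fin m → α, (∏ l, z (σ l)) * (((∑ l, b (σ l) : ℕ) : ℝ) *
        (F (∑ l, a (σ l) + c) - F (∑ l, a (σ l)))) := by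
    cases m with
    | zero => simp
    | succ m => exact mul_iidSumMean_le hz ha (hF.add_sub_mono hc) m
  refine (add_le_add_right h1 _).trans ?_
  rw [iidSumMean, iidSumMean, ← Finset.sum_add_distrib]
  refine Finset.sum_le_sum fun σ _ => ?_
  rw [← mul_add]
  refine mul_le_mul_of_nonneg_left ?_ (Finset.prod_nonneg fun _ _ => hz _)
  refine (hF.add_natCast_mul_sub_le hc _ _).trans_eq ?_
  rw [Finset.sum_add_distrib, ← Finset.sum_mul]
  push_cast
  rfl

/-- The induction step on the Poisson side: a shift by `c` with probability `p = E[b(S)]` costs no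
more than a shift by `b(S_l) c` in every copy. The size-bias identity replaces `p h` at `m` copies
by `m p h` at `m - 1` copies, after which `iidSumMean_add_le` applies for each `m`. -/
theorem compoundPoissonMean_add_le {z a : α → ℝ} {F : ℝ → ℝ} (hz : ∀ S, 0 ≤ z S)
    (ha : ∀ S, 0 ≤ a S) (hF : ConvexOn ℝ Set.univ F) (hmono : Monotone F) (h0 : ∀ t, 0 ≤ F t)
    {b : α → ℕ} {c : ℝ} (hc : 0 ≤ c) :
    compoundPoissonMean z a (fun t => F t + (∑ S, z S * b S) * (F (t + c) - F t)) ≤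
      compoundPoissonMean z (fun S => a S + b S * c) F := by
  have hp : 0 ≤ ∑ S, z S * b S := Finset.sum_nonneg fun S _ => mul_nonneg (hz S) (Nat.cast_nonneg _)
  have hh : ∀ t, 0 ≤ F (t + c) - F t := fun t => sub_nonneg.2 (hmono (by linarith))
  have e1 : ∀ m, ENNReal.ofReal (iidSumMean z a
        (fun t => F t + (∑ S, z S * b S) * (F (t + c) - F t)) m) =
      ENNReal.ofReal (iidSumMean z a F m) +
        ENNReal.ofReal ((∑ S, z S * b S) * iidSumMean z a (fun t => F (t + c) - F t) m) := by
    intro m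
    rw [← ENNReal.ofReal_add (iidSumMean_nonneg hz h0 _)
      (mul_nonneg hp (iidSumMean_nonneg hz hh _))]
    congr 1
    simp only [iidSumMean]
    rw [Finset.mul_sum, ← Finset.sum_add_distrib]
    exact Finset.sum_congr rfl fun σ _ => by ring
  rw [compoundPoissonMean]
  simp only [e1]
  rw [lintegral_add_left .of_discrete,
    ← lintegral_natCast_mul_pred_poissonMeasure_one fun m =>
      ENNReal.ofReal ((∑ S, z S * b S) * iidSumMean z a (fun t => F (t + c) - F t) m),
    ← lintegral_add_left .of_discrete]
  refine lintegral_mono fun m => ?_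
  simp only
  rw [← ENNReal.ofReal_natCast, ← ENNReal.ofReal_mul (Nat.cast_nonneg _),
    ← ENNReal.ofReal_add (iidSumMean_nonneg hz h0 _)
      (mul_nonneg (Nat.cast_nonneg _) (mul_nonneg hp (iidSumMean_nonneg hz hh _)))]
  exact ENNReal.ofReal_le_ofReal (iidSumMean_add_le hz ha hF hc m)

/-- Jensen for the average of the points `m a(S_l)`, all of which have the same law. -/
theorem iidSumMean_le {z : α → ℝ} (a : α → ℝ) {F : ℝ → ℝ} (hz : ∀ S, 0 ≤ z S)
    (hz1 : ∑ S, z S = 1) (hF : ConvexOn ℝ Set.univ F) (m : ℕ) :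
    iidSumMean z a F m ≤ ∑ S, z S * F (a S * m) := by
  cases m with
  | zero => simp [iidSumMean, ← Finset.sum_mul, hz1]
  | succ m =>
    have hm : (0 : ℝ) < ((m + 1 : ℕ) : ℝ) := by positivity
    have key : ∀ l : Fin (m + 1),
        ∑ σ : Fin (m + 1) → α, (∏ l, z (σ l)) * F (a (σ l) * (m + 1 : ℕ)) =
          ∑ S, z S * F (a S * (m + 1 : ℕ)) := by
      intro l
      rw [sum_pi_insertNth l]
      refine Finset.sum_congr rfl fun S _ => ?_
      simp only [Fin.prod_univ_succAbove _ l, Fin.insertNth_apply_same,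
        Fin.insertNth_apply_succAbove]
      rw [← Finset.sum_mul, ← Finset.mul_sum, sum_pi_prod_eq_one hz1, mul_one]
    have jensen : ∀ σ : Fin (m + 1) → α, F (∑ l, a (σ l)) ≤
        ∑ l, ((m + 1 : ℕ) : ℝ)⁻¹ * F (a (σ l) * (m + 1 : ℕ)) := by
      intro σ
      have := hF.map_sum_le (t := Finset.univ) (w := fun _ : Fin (m + 1) => ((m + 1 : ℕ) : ℝ)⁻¹)
        (p := fun l => a (σ l) * (m + 1 : ℕ)) (fun _ _ => by positivity)
        (by simp [-Nat.cast_add, hm.ne']) (fun _ _ => Set.mem_univ _)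
      simp only [smul_eq_mul] at this
      refine le_of_eq_of_le ?_ this
      congr 1
      refine Finset.sum_congr rfl fun l _ => ?_
      field_simp
    calc iidSumMean z a F (m + 1)
        ≤ ∑ σ : Fin (m + 1) → α, (∏ l, z (σ l)) *
            ∑ l, ((m + 1 : ℕ) : ℝ)⁻¹ * F (a (σ l) * (m + 1 : ℕ)) :=
          Finset.sum_le_sum fun σ _ => mul_le_mul_of_nonneg_left (jensen σ)
            (Finset.prod_nonneg fun _ _ => hz _)
      _ = ∑ l : Fin (m + 1), ((m + 1 : ℕ) : ℝ)⁻¹ *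
            ∑ σ : Fin (m + 1) → α, (∏ l, z (σ l)) * F (a (σ l) * (m + 1 : ℕ)) := by
          simp only [Finset.mul_sum]
          rw [Finset.sum_comm]
          exact Finset.sum_congr rfl fun l _ => Finset.sum_congr rfl fun σ _ => by ring
      _ = ∑ S, z S * F (a S * (m + 1 : ℕ)) := by
          simp only [key]
          rw [Finset.sum_const, Finset.card_univ, Fintype.card_fin, nsmul_eq_mul, ← mul_assoc,
            mul_inv_cancel₀ hm.ne', one_mul]

theorem compoundPoissonMean_le {z : α → ℝ} (a : α → ℝ) {F : ℝ → ℝ} (hz : ∀ S, 0 ≤ z S)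
    (hz1 : ∑ S, z S = 1) (hF : ConvexOn ℝ Set.univ F) (h0 : ∀ t, 0 ≤ F t) :
    compoundPoissonMean z a F ≤
      ∑ S, ENNReal.ofReal (z S) * ∫⁻ m : ℕ, ENNReal.ofReal (F (a S * m)) ∂(poissonMeasure 1) := by
  calc compoundPoissonMean z a F
      ≤ ∫⁻ m : ℕ, ∑ S, ENNReal.ofReal (z S) * ENNReal.ofReal (F (a S * m)) ∂(poissonMeasure 1) := by
        refine lintegral_mono fun m => ?_
        refine (ENNReal.ofReal_le_ofReal (iidSumMean_le a hz hz1 hF m)).trans_eq ?_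
        rw [ENNReal.ofReal_sum_of_nonneg fun S _ => mul_nonneg (hz S) (h0 _)]
        exact Finset.sum_congr rfl fun S _ => ENNReal.ofReal_mul (hz S)
    _ = _ := by
        rw [lintegral_finsetSum _ fun S _ => .of_discrete]
        exact Finset.sum_congr rfl fun S _ => lintegral_const_mul _ .of_discrete

end CompoundPoisson

/-! ### Negatively associated Bernoulli sums against compound Poisson sums -/

section NegativeAssociation

variable {Ω ι : Type*} [MeasurableSpace Ω] {μ : Measure Ω} {X : ι → Ω → ℝ}

theorem ProbabilityTheory.iIndepFun.negativelyAssociated (hX : iIndepFun X μ)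
    (hm : ∀ i, Measurable (X i)) : NegativelyAssociated X μ := by
  intro I J hIJ f g _ _ hf hg _ _ _
  have h := ((hX.indepFun_finset I J hIJ hm).comp hf hg).integral_fun_mul_eq_mul_integral
    (hf.comp (measurable_pi_lambda _ fun i => hm i)).aestronglyMeasurable
    (hg.comp (measurable_pi_lambda _ fun i => hm i)).aestronglyMeasurable
  exact h.le

variable [IsProbabilityMeasure μ] {d : ι → ℝ}

theorem integrable_monotone_comp_sum (hm : ∀ i, Measurable (X i))
    (h01 : ∀ i, ∀ᵐ ω ∂μ, X i ω = 0 ∨ X i ω = 1) (hd : ∀ i, 0 ≤ d i) {h : ℝ → ℝ} (hh : Monotone h)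
    (s : Finset ι) : Integrable (fun ω => h (∑ i ∈ s, d i * X i ω)) μ := by
  have hmeas : Measurable fun ω => h (∑ i ∈ s, d i * X i ω) :=
    hh.measurable.comp (Finset.measurable_fun_sum s fun i _ => (hm i).const_mul _)
  have hs : ∀ᵐ ω ∂μ, ∀ i ∈ s, X i ω = 0 ∨ X i ω = 1 :=
    (Filter.eventually_all_finset s).2 fun i _ => h01 i
  refine Integrable.of_mem_Icc (h 0) (h (∑ i ∈ s, d i)) hmeas.aemeasurable ?_
  filter_upwards [hs] with ω hω
  refine ⟨hh (Finset.sum_nonneg fun i hi => ?_), hh (Finset.sum_le_sum fun i hi => ?_)⟩ <;>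
  rcases hω i hi with h | h <;> simp [h, hd i]

theorem NegativelyAssociated.integral_mul_comp_sum_le (hX : NegativelyAssociated X μ)
    (hm : ∀ i, Measurable (X i)) (h01 : ∀ i, ∀ᵐ ω ∂μ, X i ω = 0 ∨ X i ω = 1) (hd : ∀ i, 0 ≤ d i)
    {h : ℝ → ℝ} (hh : Monotone h) {s : Finset ι} {i : ι} (hi : i ∉ s) :
    Integrable (fun ω => X i ω * h (∑ i ∈ s, d i * X i ω)) μ ∧
    ∫ ω, X i ω * h (∑ i ∈ s, d i * X i ω) ∂μ ≤
      (∫ ω, X i ω ∂μ) * ∫ ω, h (∑ i ∈ s, d i * X i ω) ∂μ := by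
  have hint := integrable_monotone_comp_sum hm h01 hd hh s
  have hXi : Integrable (X i) μ := by
    refine Integrable.of_mem_Icc 0 1 (hm i).aemeasurable ?_
    filter_upwards [h01 i] with ω hω
    rcases hω with h | h <;> simp [h]
  have hprod : Integrable (fun ω => X i ω * h (∑ i ∈ s, d i * X i ω)) μ := by
    refine hint.bdd_mul (c := 1) (hm i).aestronglyMeasurable ?_
    filter_upwards [h01 i] with ω hω
    rcases hω with h | h <;> simp [h]
  refine ⟨hprod, ?_⟩
  have e : ∀ ω, ∑ j : s, d j * X j ω = ∑ j ∈ s, d j * X j ω := fun ω =>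
    Finset.sum_coe_sort s fun j => d j * X j ω
  have := hX {i} s (Finset.disjoint_singleton_left.2 hi)
    (fun x => x ⟨i, Finset.mem_singleton_self i⟩) (fun x => h (∑ j : s, d j * x j))
    (fun x y hxy => hxy _)
    (fun x y hxy => hh (Finset.sum_le_sum fun j _ => mul_le_mul_of_nonneg_left (hxy j) (hd j)))
    (measurable_pi_apply _)
    (hh.measurable.comp (Finset.measurable_fun_sum _ fun j _ => (measurable_pi_apply j).const_mul _))
  simp only [e] at this
  exact this hXi hint hprod

/-- A nonnegative combination of negatively associated Bernoulli variables is dominated, in the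
increasing convex order, by a compound Poisson sum. -/
theorem NegativelyAssociated.integral_le_compoundPoissonMean {α : Type*} [Fintype α]
    (hX : NegativelyAssociated X μ) (hm : ∀ i, Measurable (X i))
    (h01 : ∀ i, ∀ᵐ ω ∂μ, X i ω = 0 ∨ X i ω = 1) (hd : ∀ i, 0 ≤ d i)
    {z : α → ℝ} (hz : ∀ S, 0 ≤ z S) (hz1 : ∑ S, z S = 1) {b : α → ι → ℕ}
    (hb : ∀ i, ∑ S, z S * b S i = ∫ ω, X i ω ∂μ) (s : Finset ι) :
    ∀ F : ℝ → ℝ, ConvexOn ℝ Set.univ F → Monotone F → (∀ t, 0 ≤ F t) →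
      ENNReal.ofReal (∫ ω, F (∑ i ∈ s, d i * X i ω) ∂μ) ≤
        compoundPoissonMean z (fun S => ∑ i ∈ s, b S i * d i) F := by
  classical
  induction s using Finset.induction_on with
  | empty =>
    intro F _ _ _
    simp [compoundPoissonMean, iidSumMean, ← Finset.sum_mul, sum_pi_prod_eq_one hz1]
  | insert i s hi ih =>
    intro F hF hmono h0
    set p := ∑ S, z S * b S i with hp
    have hp0 : 0 ≤ p := Finset.sum_nonneg fun S _ => mul_nonneg (hz S) (Nat.cast_nonneg _)
    have hp1 : p ≤ 1 := by
      rw [hp, hb i]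
      calc ∫ ω, X i ω ∂μ ≤ ∫ _, (1 : ℝ) ∂μ := by
            refine integral_mono_of_nonneg ?_ (integrable_const _) ?_ <;>
            filter_upwards [h01 i] with ω hω <;>
            rcases hω with h | h <;> simp [h]
        _ = 1 := by simp
    set h : ℝ → ℝ := fun t => F (t + d i) - F t with hh
    have hhm : Monotone h := hF.add_sub_mono (hd i)
    obtain ⟨hi1, hle⟩ := hX.integral_mul_comp_sum_le hm h01 hd hhm hi
    -- The new test function is a mixture of `F` and a translate of it, hence again convex; the
    -- induction hypothesis must therefore quantify over all `F`.
    have hG : (fun t => F t + p * h t) = (1 - p) • F + p • fun t => F (t + d i) := by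
      ext t; simp only [hh, Pi.add_apply, Pi.smul_apply, smul_eq_mul]; ring
    have hFs : ConvexOn ℝ Set.univ fun t => F (t + d i) := by
      have := hF.translate_left (d i)
      rw [Set.preimage_univ] at this
      exact this
    have hGc : ConvexOn ℝ Set.univ fun t => F t + p * h t := by
      rw [hG]
      exact (hF.smul (sub_nonneg.2 hp1)).add (hFs.smul hp0)
    have hGm : Monotone fun t => F t + p * h t := hmono.add (hhm.const_mul hp0)
    have hG0 : ∀ t, 0 ≤ F t + p * h t := fun t =>
      add_nonneg (h0 t) (mul_nonneg hp0 (sub_nonneg.2 (hmono (by linarith [hd i]))))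
    have hstep : ∫ ω, F (∑ j ∈ insert i s, d j * X j ω) ∂μ ≤
        ∫ ω, (F (∑ j ∈ s, d j * X j ω) + p * h (∑ j ∈ s, d j * X j ω)) ∂μ := by
      -- Since `X i` is 0 or 1, `F (t + d i * X i) = F t + X i * h t`.
      calc _ = ∫ ω, (F (∑ j ∈ s, d j * X j ω) + X i ω * h (∑ j ∈ s, d j * X j ω)) ∂μ := by
            refine integral_congr_ae ?_
            filter_upwards [h01 i] with ω hω
            rw [Finset.sum_insert hi]
            rcases hω with h | h <;> simp [h, hh, add_comm]
        _ ≤ _ := by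
            rw [integral_add (integrable_monotone_comp_sum hm h01 hd hmono s) hi1,
              integral_add (integrable_monotone_comp_sum hm h01 hd hmono s)
                ((integrable_monotone_comp_sum hm h01 hd hhm s).const_mul _),
              integral_const_mul, hp, hb i]
            exact add_le_add_right hle _
    refine (ENNReal.ofReal_le_ofReal hstep).trans ((ih _ hGc hGm hG0).trans ?_)
    have := compoundPoissonMean_add_le (a := fun S => ∑ j ∈ s, b S j * d j) hz
      (fun S => Finset.sum_nonneg fun j _ => mul_nonneg (Nat.cast_nonneg _) (hd j)) hF hmono h0
      (b := fun S => b S i) (hd i)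
    refine this.trans_eq ?_
    congr 1
    ext S
    rw [Finset.sum_insert hi, add_comm]

end NegativeAssociation

/-! ### The constants `A(f)` and `A_q` -/

section PoissonRatio

theorem poissonRatio_congr {f g : ℝ → ℝ} (h : ∀ t, 0 ≤ t → f t = g t) :
    poissonRatio f = poissonRatio g := by
  unfold poissonRatio
  refine iSup_congr fun t => iSup_congr fun ht => ?_
  refine lintegral_congr fun m => ?_
  rw [h t ht.le, h (t * m) (by positivity)]

theorem lintegral_le_poissonRatio_mul {f : ℝ → ℝ} (hA : poissonRatio f ≠ ∞) {t : ℝ} (ht : 0 < t) :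
    ∫⁻ m : ℕ, ENNReal.ofReal (f (t * m)) ∂(poissonMeasure 1) ≤
      poissonRatio f * ENNReal.ofReal (f t) := by
  have hle : ∫⁻ m : ℕ, ENNReal.ofReal (f (t * m)) / ENNReal.ofReal (f t) ∂(poissonMeasure 1) ≤
      poissonRatio f := le_iSup₂_of_le t ht le_rfl
  -- The Poisson law charges every natural number, so a finite integral makes every ratio finite.
  -- Hence `f t = 0` forces `f (t * m)` to contribute 0, and the division cancels.
  have hfin := ae_poissonMeasure_one_iff.1 (ae_lt_top' (Measurable.of_discrete.aemeasurable)
    (hle.trans_lt hA.lt_top).ne)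
  have heq : ∀ m : ℕ, ENNReal.ofReal (f (t * m)) =
      ENNReal.ofReal (f (t * m)) / ENNReal.ofReal (f t) * ENNReal.ofReal (f t) := by
    intro m
    refine (ENNReal.div_mul_cancel' (fun h => ?_) fun h => absurd h ENNReal.ofReal_ne_top).symm
    by_contra hne
    have := hfin m
    rw [h, ENNReal.div_zero hne] at this
    exact lt_irrefl _ this
  calc _ = ∫⁻ m : ℕ, ENNReal.ofReal (f (t * m)) / ENNReal.ofReal (f t) * ENNReal.ofReal (f t)
        ∂(poissonMeasure 1) := lintegral_congr heq
    _ = (∫⁻ m : ℕ, ENNReal.ofReal (f (t * m)) / ENNReal.ofReal (f t) ∂(poissonMeasure 1)) *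
        ENNReal.ofReal (f t) := lintegral_mul_const _ .of_discrete
    _ ≤ _ := mul_le_mul_left hle _

/-- The supremum omits `t = 0`, but sets of weight 0 need that case. It is the limit `t → 0+`, where
the chord from 0 to 1 bounds `f t` from above. -/
theorem ofReal_zero_le_poissonRatio_mul {f : ℝ → ℝ} (h0 : ∀ t, 0 ≤ t → 0 ≤ f t)
    (hm : MonotoneOn f (Set.Ici 0)) (hf : ConvexOn ℝ (Set.Ici 0) f) (hA : poissonRatio f ≠ ∞) :
    ENNReal.ofReal (f 0) ≤ poissonRatio f * ENNReal.ofReal (f 0) := by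
  have key : ∀ t : ℝ, 0 < t → t ≤ 1 →
      f 0 ≤ (poissonRatio f).toReal * ((1 - t) * f 0 + t * f 1) := by
    intro t ht ht1
    have h1 : f t ≤ (1 - t) * f 0 + t * f 1 := by
      simpa using hf.2 (Set.mem_Ici.2 le_rfl) (Set.mem_Ici.2 zero_le_one) (sub_nonneg.2 ht1) ht.le
        (sub_add_cancel 1 t)
    refine le_trans ?_ (mul_le_mul_of_nonneg_left h1 ENNReal.toReal_nonneg)
    rw [← ENNReal.ofReal_le_ofReal_iff (mul_nonneg ENNReal.toReal_nonneg (h0 t ht.le)),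
      ENNReal.ofReal_mul ENNReal.toReal_nonneg, ENNReal.ofReal_toReal hA]
    refine le_trans ?_ (lintegral_le_poissonRatio_mul hA ht)
    calc ENNReal.ofReal (f 0) = ∫⁻ _ : ℕ, ENNReal.ofReal (f 0) ∂(poissonMeasure 1) := by simp
      _ ≤ _ := lintegral_mono fun m => ENNReal.ofReal_le_ofReal
        (hm (Set.mem_Ici.2 le_rfl) (Set.mem_Ici.2 (by positivity)) (by positivity))
  have hlim : Filter.Tendsto (fun t : ℝ => (poissonRatio f).toReal * ((1 - t) * f 0 + t * f 1))
      (nhdsWithin 0 (Set.Ioi 0)) (nhds ((poissonRatio f).toReal * ((1 - 0) * f 0 + 0 * f 1))) :=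
    (Continuous.tendsto (by fun_prop) 0).mono_left nhdsWithin_le_nhds
  have := ge_of_tendsto hlim (by
    filter_upwards [Ioc_mem_nhdsGT (zero_lt_one (α := ℝ))] with t ht using key t ht.1 ht.2)
  simp only [sub_zero, one_mul, zero_mul, add_zero] at this
  calc ENNReal.ofReal (f 0) ≤ ENNReal.ofReal ((poissonRatio f).toReal * f 0) :=
        ENNReal.ofReal_le_ofReal this
    _ = _ := by rw [ENNReal.ofReal_mul ENNReal.toReal_nonneg, ENNReal.ofReal_toReal hA]

theorem lintegral_le_poissonRatio_mul_of_nonneg {f : ℝ → ℝ} (h0 : ∀ t, 0 ≤ t → 0 ≤ f t)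
    (hm : MonotoneOn f (Set.Ici 0)) (hf : ConvexOn ℝ (Set.Ici 0) f) (hA : poissonRatio f ≠ ∞)
    {t : ℝ} (ht : 0 ≤ t) :
    ∫⁻ m : ℕ, ENNReal.ofReal (f (t * m)) ∂(poissonMeasure 1) ≤
      poissonRatio f * ENNReal.ofReal (f t) := by
  rcases ht.eq_or_lt with rfl | ht
  · simpa using ofReal_zero_le_poissonRatio_mul h0 hm hf hA
  · exact lintegral_le_poissonRatio_mul hA ht

theorem fractionalBell_ne_zero (q : ℝ) : fractionalBell q ≠ 0 := by
  intro h
  rw [fractionalBell, lintegral_eq_zero_iff' Measurable.of_discrete.aemeasurable] at h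
  have := ae_poissonMeasure_one_iff.1 h 1
  simp at this

theorem fractionalBell_ne_top (q : ℝ) : fractionalBell q ≠ ∞ := by
  obtain ⟨N, hN⟩ := exists_nat_ge q
  -- From `m ^ N / N! ≤ e ^ m`; the extra 1 covers `m = 0`, where `0 ^ q` can be 1. Dividing by `m!`
  -- leaves a convergent exponential series.
  have hbound : ∀ m : ℕ, (m : ℝ) ^ q ≤ (N.factorial + 1) * Real.exp 1 ^ m := by
    intro m
    rcases Nat.eq_zero_or_pos m with rfl | hm
    · have h1 : ((0 : ℕ) : ℝ) ^ q ≤ 1 := by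
        rcases eq_or_ne q 0 with rfl | hq <;> simp [*]
      have h2 : (0 : ℝ) ≤ N.factorial := by positivity
      simpa using h1.trans (by linarith)
    · have h1 : (m : ℝ) ^ q ≤ (m : ℝ) ^ N := by
        rw [← Real.rpow_natCast]
        exact Real.rpow_le_rpow_of_exponent_le (by exact_mod_cast hm) hN
      have h2 := Real.pow_div_factorial_le_exp (x := (m : ℝ)) (by positivity) N
      rw [div_le_iff₀ (by positivity)] at h2
      have h3 : Real.exp m = Real.exp 1 ^ m := by rw [← Real.exp_nat_mul, mul_one]
      rw [h3] at h2
      have h4 : (0 : ℝ) < Real.exp 1 ^ m := by positivity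
      linarith
  rw [fractionalBell, lintegral_poissonMeasure_one]
  have hsum : Summable fun m : ℕ =>
      Real.exp (-1) * (N.factorial + 1) * (Real.exp 1 ^ m / m.factorial) :=
    (Real.summable_pow_div_factorial _).mul_left _
  refine ne_top_of_le_ne_top hsum.tsum_ofReal_ne_top (ENNReal.tsum_le_tsum fun m => ?_)
  rw [← ENNReal.ofReal_mul (by positivity)]
  refine ENNReal.ofReal_le_ofReal ?_
  calc _ ≤ Real.exp (-1) / m.factorial * ((N.factorial + 1) * Real.exp 1 ^ m) :=
        mul_le_mul_of_nonneg_left (hbound m) (by positivity)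
    _ = _ := by ring

theorem poissonRatio_const_mul_rpow (q : ℝ) {c : ℝ} (hc : 0 < c) :
    poissonRatio (fun t => c * t ^ q) = fractionalBell q := by
  have h : ∀ t : ℝ, 0 < t → ∫⁻ m : ℕ, ENNReal.ofReal (c * (t * m) ^ q) / ENNReal.ofReal (c * t ^ q)
      ∂(poissonMeasure 1) = fractionalBell q := by
    intro t ht
    refine lintegral_congr fun m => ?_
    rw [← ENNReal.ofReal_div_of_pos (by positivity), Real.mul_rpow ht.le (Nat.cast_nonneg _)]
    congr 1
    have : t ^ q ≠ 0 := (Real.rpow_pos_of_pos ht q).ne'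
    field_simp
  unfold poissonRatio
  refine le_antisymm (iSup₂_le fun t ht => (h t ht).le) (le_iSup₂_of_le 1 one_pos (h 1 one_pos).ge)

theorem poissonRatio_const_mul_rpow_le (q : ℝ) {c : ℝ} (hc : 0 ≤ c) :
    poissonRatio (fun t => c * t ^ q) ≤ fractionalBell q := by
  rcases hc.eq_or_lt with rfl | hc
  · simp [poissonRatio]
  · exact (poissonRatio_const_mul_rpow q hc).le

end PoissonRatio

/-! ### The linear program, the rounding and the integrality gap -/

namespace BooleanConvexProgram

variable {n k : ℕ} {Q : BooleanConvexProgram n k}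

section LinearProgram

variable {y : Fin n → ℝ} {z : Fin k → Finset (Fin n) → ℝ}

theorem LPFeasible.lpTerm_nonneg (hyz : Q.LPFeasible y z) (j : Fin k) : 0 ≤ Q.lpTerm z j :=
  Finset.sum_nonneg fun S _ => mul_nonneg
    (Q.f_nonneg j _ (Finset.sum_nonneg fun i _ => Q.d_nonneg i j)) (hyz.nonneg j S)

theorem LPFeasible.ofReal_lpCost (hyz : Q.LPFeasible y z) :
    ENNReal.ofReal (Q.lpCost z) = ∑ j, ENNReal.ofReal (Q.lpTerm z j) :=
  ENNReal.ofReal_sum_of_nonneg fun j _ => hyz.lpTerm_nonneg j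

theorem exists_lpFeasible_of_mem_integralPoints (hy : y ∈ Q.integralPoints) :
    ∃ z, Q.LPFeasible y z ∧ Q.lpCost z = Q.cost y := by
  classical
  -- An integral point is the configuration putting all mass, for every `j`, on its own support.
  set T : Finset (Fin n) := {i | y i = 1} with hT
  refine ⟨fun _ S => if S = T then 1 else 0, ⟨hy.1, fun j => by simp, fun i j => ?_, fun j S => ?_⟩,
    ?_⟩
  · rw [Finset.sum_ite_eq']
    rcases hy.2 i with h | h <;> simp [hT, h]
  · positivity
  · refine Finset.sum_congr rfl fun j _ => ?_
    rw [lpTerm]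
    simp only [mul_ite, mul_one, mul_zero, Finset.sum_ite_eq', Finset.mem_univ, if_true]
    congr 1
    rw [hT, Finset.sum_filter]
    refine Finset.sum_congr rfl fun i _ => ?_
    rcases hy.2 i with h | h <;> simp [h]

theorem lpValue_le (hyz : Q.LPFeasible y z) : Q.lpValue ≤ ENNReal.ofReal (Q.lpCost z) :=
  iInf_le_of_le y (iInf_le_of_le z (iInf_le_of_le hyz le_rfl))

variable (Q) in
theorem lpValue_le_ipValue : Q.lpValue ≤ Q.ipValue := by
  refine le_iInf₂ fun y hy => ?_
  obtain ⟨z, hz, hc⟩ := exists_lpFeasible_of_mem_integralPoints hy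
  exact hc ▸ lpValue_le hz

theorem poissonRatio_le_maxRatio (j : Fin k) : poissonRatio (Q.f j) ≤ Q.maxRatio :=
  le_iSup (fun j => poissonRatio (Q.f j)) j

end LinearProgram

section Rounding

variable {Ω : Type*} [MeasurableSpace Ω] {μ : Measure Ω}
  {R : (Fin n → ℝ) → Ω → Fin n → ℝ} {y : Fin n → ℝ} {z : Fin k → Finset (Fin n) → ℝ}

theorem IsRounding.ae_eq_zero_or_one (hR : Q.IsRounding μ R) (hy : y ∈ Q.P) (i : Fin n) :
    ∀ᵐ ω ∂μ, R y ω i = 0 ∨ R y ω i = 1 :=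
  (hR.integral y hy).mono fun _ h => h.2 i

theorem IsRounding.measurable_apply (hR : Q.IsRounding μ R) (hy : y ∈ Q.P) (i : Fin n) :
    Measurable fun ω => R y ω i :=
  (measurable_pi_apply i).comp (hR.measurable y hy)

theorem IsRounding.integral_apply (hR : Q.IsRounding μ R) (hy : y ∈ Q.P) (i : Fin n) :
    ∫ ω, R y ω i ∂μ = y i := by
  have hs : MeasurableSet {ω | R y ω i = 1} :=
    hR.measurable_apply hy i (measurableSet_singleton 1)
  calc ∫ ω, R y ω i ∂μ = ∫ ω, {ω | R y ω i = 1}.indicator 1 ω ∂μ := by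
        refine integral_congr_ae ?_
        filter_upwards [hR.ae_eq_zero_or_one hy i] with ω hω
        rcases hω with h | h <;> simp [Set.indicator, h]
    _ = y i := by
        rw [integral_indicator_one hs, measureReal_def, hR.marginal y hy i,
          ENNReal.toReal_ofReal (Q.P_subset hy i).1]

theorem IsRounding.negativelyAssociated (hR : Q.IsRounding μ R) (hy : y ∈ Q.P) (j : Fin k) :
    NegativelyAssociated (fun (i : {i : Fin n // Q.d i j ≠ 0}) ω => R y ω i) μ :=
  (hR.dependence y hy j).elim
    (fun h => h.negativelyAssociated fun i => hR.measurable_apply hy i) id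

variable [IsProbabilityMeasure μ]

theorem sum_subtype_d_ne_zero (j : Fin k) (x : Fin n → ℝ) :
    ∑ i : {i : Fin n // Q.d i j ≠ 0}, Q.d i j * x i = ∑ i, Q.d i j * x i := by
  classical
  rw [← Finset.sum_filter_add_sum_filter_not Finset.univ (fun i => Q.d i j ≠ 0)
    fun i => Q.d i j * x i, Finset.sum_subtype ({i | Q.d i j ≠ 0} : Finset (Fin n))
    (p := fun i => Q.d i j ≠ 0) (by simp), left_eq_add]
  exact Finset.sum_eq_zero fun i hi => by simp_all

theorem IsRounding.lintegral_term_le (hR : Q.IsRounding μ R) (hyz : Q.LPFeasible y z) (j : Fin k)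
    (hj : poissonRatio (Q.f j) ≠ ∞ ∨ Q.lpTerm z j ≠ 0) :
    ∫⁻ ω, ENNReal.ofReal (Q.f j (∑ i, Q.d i j * R y ω i)) ∂μ ≤
      poissonRatio (Q.f j) * ENNReal.ofReal (Q.lpTerm z j) := by
  classical
  rcases eq_or_ne (poissonRatio (Q.f j)) ∞ with hA | hA
  · have : 0 < Q.lpTerm z j :=
      lt_of_le_of_ne (hyz.lpTerm_nonneg j) (hj.resolve_left (not_not.2 hA)).symm
    rw [hA, ENNReal.top_mul (ENNReal.ofReal_pos.2 this).ne']
    exact le_top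
  have hy := hyz.mem
  let X : {i : Fin n // Q.d i j ≠ 0} → Ω → ℝ := fun i ω => R y ω i
  let d : {i : Fin n // Q.d i j ≠ 0} → ℝ := fun i => Q.d i j
  -- With membership indicators as multiplicities, the marginal constraint of the linear program
  -- says exactly that `b` has the mean of `X`.
  let b : Finset (Fin n) → {i : Fin n // Q.d i j ≠ 0} → ℕ :=
    fun S i => if (i : Fin n) ∈ S then 1 else 0
  let F : ℝ → ℝ := fun t => Q.f j (max t 0)
  have hF : ConvexOn ℝ Set.univ F := (Q.f_convex j).comp_max_zero (Q.f_mono j)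
  have hFm : Monotone F := (Q.f_mono j).comp_max_zero
  have hF0 : ∀ t, 0 ≤ F t := fun t => Q.f_nonneg j _ (le_max_right _ _)
  have hFf : ∀ t, 0 ≤ t → F t = Q.f j t := fun t ht => by simp only [F, max_eq_left ht]
  have hm : ∀ i, Measurable (X i) := fun i => hR.measurable_apply hy i
  have h01 : ∀ i, ∀ᵐ ω ∂μ, X i ω = 0 ∨ X i ω = 1 := fun i => hR.ae_eq_zero_or_one hy i
  have hd : ∀ i, 0 ≤ d i := fun i => Q.d_nonneg i j
  have hb : ∀ i, ∑ S, z j S * b S i = ∫ ω, X i ω ∂μ := by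
    intro i
    rw [show ∫ ω, X i ω ∂μ = y i from hR.integral_apply hy i, ← hyz.sum_eq i j, Finset.sum_filter]
    refine Finset.sum_congr rfl fun S _ => ?_
    by_cases h : (i : Fin n) ∈ S <;> simp [b, h]
  have ha : ∀ S : Finset (Fin n), ∑ i, b S i * d i = ∑ i ∈ S, Q.d i j := by
    intro S
    have := sum_subtype_d_ne_zero (Q := Q) j fun i => if i ∈ S then 1 else 0
    simp only [mul_ite, mul_one, mul_zero, Finset.sum_ite_mem, Finset.univ_inter] at this
    rw [← this]
    refine Finset.sum_congr rfl fun i _ => ?_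
    by_cases h : (i : Fin n) ∈ S <;> simp [b, d, h]
  have hS0 : ∀ S : Finset (Fin n), 0 ≤ ∑ i ∈ S, Q.d i j := fun S =>
    Finset.sum_nonneg fun i _ => Q.d_nonneg i j
  calc ∫⁻ ω, ENNReal.ofReal (Q.f j (∑ i, Q.d i j * R y ω i)) ∂μ
      = ∫⁻ ω, ENNReal.ofReal (F (∑ i, d i * X i ω)) ∂μ := by
        refine lintegral_congr_ae ?_
        filter_upwards [hR.integral y hy] with ω hω
        rw [← sum_subtype_d_ne_zero, hFf]
        exact Finset.sum_nonneg fun i _ => mul_nonneg (hd i) (Q.P_subset hω.1 i).1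
    _ = ENNReal.ofReal (∫ ω, F (∑ i, d i * X i ω) ∂μ) :=
        (ofReal_integral_eq_lintegral_ofReal (integrable_monotone_comp_sum hm h01 hd hFm _)
          (Filter.Eventually.of_forall fun _ => hF0 _)).symm
    _ ≤ compoundPoissonMean (z j) (fun S => ∑ i, b S i * d i) F :=
        (hR.negativelyAssociated hy j).integral_le_compoundPoissonMean hm h01 hd (hyz.nonneg j)
          (hyz.sum_eq_one j) hb Finset.univ F hF hFm hF0
    _ ≤ ∑ S, ENNReal.ofReal (z j S) *
          ∫⁻ m : ℕ, ENNReal.ofReal (F ((∑ i, b S i * d i) * m)) ∂(poissonMeasure 1) :=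
        compoundPoissonMean_le _ (hyz.nonneg j) (hyz.sum_eq_one j) hF hF0
    _ ≤ ∑ S, poissonRatio (Q.f j) * ENNReal.ofReal (Q.f j (∑ i ∈ S, Q.d i j) * z j S) := by
        refine Finset.sum_le_sum fun S _ => ?_
        rw [ENNReal.ofReal_mul (Q.f_nonneg j _ (hS0 S)), ← mul_assoc,
          mul_comm (ENNReal.ofReal (z j S))]
        refine mul_le_mul_left ?_ _
        refine le_of_eq_of_le (lintegral_congr fun m => ?_)
          (lintegral_le_poissonRatio_mul_of_nonneg (Q.f_nonneg j) (Q.f_mono j) (Q.f_convex j) hA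
            (hS0 S))
        rw [ha, hFf _ (mul_nonneg (hS0 S) (Nat.cast_nonneg _))]
    _ = poissonRatio (Q.f j) * ENNReal.ofReal (Q.lpTerm z j) := by
        rw [← Finset.mul_sum, lpTerm, ENNReal.ofReal_sum_of_nonneg]
        exact fun S _ => mul_nonneg (Q.f_nonneg j _ (hS0 S)) (hyz.nonneg j S)

theorem IsRounding.expectedCost_le (hR : Q.IsRounding μ R) (hyz : Q.LPFeasible y z)
    (hA : ∀ j, poissonRatio (Q.f j) ≠ ∞ ∨ Q.lpTerm z j ≠ 0) :
    Q.expectedCost μ (R y) ≤ ∑ j, poissonRatio (Q.f j) * ENNReal.ofReal (Q.lpTerm z j) := by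
  have hy := hyz.mem
  calc Q.expectedCost μ (R y)
      = ∫⁻ ω, ∑ j, ENNReal.ofReal (Q.f j (∑ i, Q.d i j * R y ω i)) ∂μ := by
        refine lintegral_congr_ae ?_
        filter_upwards [hR.integral y hy] with ω hω
        exact ENNReal.ofReal_sum_of_nonneg fun j _ => Q.f_nonneg j _
          (Finset.sum_nonneg fun i _ => mul_nonneg (Q.d_nonneg i j) (Q.P_subset hω.1 i).1)
    _ = ∑ j, ∫⁻ ω, ENNReal.ofReal (Q.f j (∑ i, Q.d i j * R y ω i)) ∂μ := by
        refine lintegral_finsetSum' _ fun j _ => ?_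
        have hX : Measurable fun ω => Q.f j (max (∑ i, Q.d i j * R y ω i) 0) :=
          (Q.f_mono j).comp_max_zero.measurable.comp
            (Finset.measurable_fun_sum _ fun i _ => (hR.measurable_apply hy i).const_mul _)
        refine hX.ennreal_ofReal.aemeasurable.congr ?_
        filter_upwards [hR.integral y hy] with ω hω
        rw [max_eq_left]
        exact Finset.sum_nonneg fun i _ => mul_nonneg (Q.d_nonneg i j) (Q.P_subset hω.1 i).1
    _ ≤ _ := Finset.sum_le_sum fun j _ => hR.lintegral_term_le hyz j (hA j)

theorem IsRounding.expectedCost_le_of_forall_poissonRatio_le (hR : Q.IsRounding μ R)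
    (hyz : Q.LPFeasible y z) {A : ℝ≥0∞} (hA : ∀ j, poissonRatio (Q.f j) ≤ A) (hA' : A ≠ ∞) :
    Q.expectedCost μ (R y) ≤ A * ENNReal.ofReal (Q.lpCost z) := by
  refine (hR.expectedCost_le hyz fun j => .inl (ne_top_of_le_ne_top hA' (hA j))).trans ?_
  rw [hyz.ofReal_lpCost, Finset.mul_sum]
  exact Finset.sum_le_sum fun j _ => mul_le_mul_left (hA j) _

theorem IsRounding.expectedCost_le_mul_ipValue (hR : Q.IsRounding μ R) {ε : ℝ}
    (hyz : Q.LPApproxOptimal ε y z) {A : ℝ≥0∞} (hA : ∀ j, poissonRatio (Q.f j) ≤ A)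
    (hA' : A ≠ ∞) : Q.expectedCost μ (R y) ≤ ENNReal.ofReal (1 + ε) * A * Q.ipValue := by
  calc _ ≤ A * ENNReal.ofReal (Q.lpCost z) :=
        hR.expectedCost_le_of_forall_poissonRatio_le hyz.1 hA hA'
    _ ≤ A * (ENNReal.ofReal (1 + ε) * Q.ipValue) :=
        mul_le_mul_right (hyz.2.trans (mul_le_mul_right Q.lpValue_le_ipValue _)) _
    _ = _ := by rw [← mul_assoc, mul_comm A]

theorem IsRounding.ipValue_le_expectedCost (hR : Q.IsRounding μ R) (hy : y ∈ Q.P) :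
    Q.ipValue ≤ Q.expectedCost μ (R y) := by
  calc Q.ipValue = ∫⁻ _, Q.ipValue ∂μ := by simp
    _ ≤ _ := by
      refine lintegral_mono_ae ?_
      filter_upwards [hR.integral y hy] with ω hω
      exact iInf₂_le _ hω

theorem IsRounding.ipValue_le_mul_lpValue (hR : Q.IsRounding μ R) (hP : Q.P.Nonempty)
    {A : ℝ≥0∞} (hA : ∀ j, poissonRatio (Q.f j) ≤ A) (hA' : A ≠ ∞) :
    Q.ipValue ≤ A * Q.lpValue := by
  have key : ∀ y z, Q.LPFeasible y z → Q.ipValue ≤ A * ENNReal.ofReal (Q.lpCost z) :=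
    fun y z hyz => (hR.ipValue_le_expectedCost hyz.mem).trans
      (hR.expectedCost_le_of_forall_poissonRatio_le hyz hA hA')
  -- For `A = 0` the right side is 0 by convention even if the linear program were infeasible, so a
  -- feasible solution is needed: the rounding of a point of `P` provides one.
  rcases eq_or_ne A 0 with rfl | h0
  · obtain ⟨y, hy⟩ := hP
    obtain ⟨ω, hω⟩ := (hR.integral y hy).exists
    obtain ⟨z, hz, -⟩ := exists_lpFeasible_of_mem_integralPoints hω
    simpa using key _ z hz
  · rw [mul_comm, ← ENNReal.div_le_iff h0 hA']
    refine le_iInf fun y => le_iInf fun z => le_iInf fun hyz => ?_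
    rw [ENNReal.div_le_iff h0 hA', mul_comm]
    exact key y z hyz

end Rounding

theorem lpValue_eq_top_of_P_eq_empty (hP : Q.P = ∅) : Q.lpValue = ∞ := by
  simp only [lpValue, iInf_eq_top]
  intro y z hyz
  exact absurd hyz.mem (hP ▸ Set.notMem_empty y)

end BooleanConvexProgram

theorem mainTheorem3 {n k : ℕ} (Q : BooleanConvexProgram n k)
    {Ω : Type*} [MeasurableSpace Ω] (μ : Measure Ω) [IsProbabilityMeasure μ]
    (R : (Fin n → ℝ) → Ω → Fin n → ℝ) (hR : Q.IsRounding μ R) :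
    -- the bound for every feasible solution (provided that no product on the right is `∞ * 0`)
    (∀ y z, Q.LPFeasible y z →
      (∀ j, poissonRatio (Q.f j) ≠ ∞ ∨ Q.lpTerm z j ≠ 0) →
      Q.expectedCost μ (R y) ≤
        ∑ j, poissonRatio (Q.f j) * ENNReal.ofReal (Q.lpTerm z j)) ∧
    -- the linear program is a relaxation
    Q.lpValue ≤ Q.ipValue ∧
    -- approximately optimal solutions
    (∀ ε : ℝ, 0 ≤ ε → ∀ y z, Q.LPApproxOptimal ε y z →
      (Q.maxRatio ≠ ∞ ∨ Q.ipValue ≠ 0) →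
      Q.expectedCost μ (R y) ≤ ENNReal.ofReal (1 + ε) * Q.maxRatio * Q.ipValue) ∧
    -- the integrality gap
    (Q.P.Nonempty → (Q.maxRatio ≠ ∞ ∨ Q.lpValue ≠ 0) →
      Q.ipValue ≤ Q.maxRatio * Q.lpValue) ∧
    -- the case of powers
    (∀ q : ℝ, 1 ≤ q →
      fractionalBell q ≠ ∞ ∧
      (∀ c : ℝ, 0 < c → poissonRatio (fun t => c * t ^ q) = fractionalBell q) ∧
      (∀ c : Fin k → ℝ, (∀ j, 0 ≤ c j) → (∀ j t, 0 ≤ t → Q.f j t = c j * t ^ q) →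
        (∀ y z, Q.LPFeasible y z →
          Q.expectedCost μ (R y) ≤ fractionalBell q * ENNReal.ofReal (Q.lpCost z)) ∧
        (∀ ε : ℝ, 0 ≤ ε → ∀ y z, Q.LPApproxOptimal ε y z →
          Q.expectedCost μ (R y) ≤ ENNReal.ofReal (1 + ε) * fractionalBell q * Q.ipValue) ∧
        Q.ipValue ≤ fractionalBell q * Q.lpValue)) := by
  refine ⟨fun y z hyz hA => hR.expectedCost_le hyz hA, Q.lpValue_le_ipValue, ?_, ?_, ?_⟩
  · intro ε hε y z hyz hA
    rcases eq_or_ne Q.maxRatio ∞ with h | h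
    · rw [h, ENNReal.mul_top (ENNReal.ofReal_pos.2 (by linarith)).ne',
        ENNReal.top_mul (hA.resolve_left (not_not.2 h))]
      exact le_top
    · exact hR.expectedCost_le_mul_ipValue hyz
        BooleanConvexProgram.poissonRatio_le_maxRatio h
  · intro hP hA
    rcases eq_or_ne Q.maxRatio ∞ with h | h
    · rw [h, ENNReal.top_mul (hA.resolve_left (not_not.2 h))]
      exact le_top
    · exact hR.ipValue_le_mul_lpValue hP BooleanConvexProgram.poissonRatio_le_maxRatio h
  · intro q _
    refine ⟨fractionalBell_ne_top q, fun c hc => poissonRatio_const_mul_rpow q hc, ?_⟩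
    intro c hc hf
    have hA : ∀ j, poissonRatio (Q.f j) ≤ fractionalBell q := fun j =>
      (poissonRatio_congr (hf j)).trans_le (poissonRatio_const_mul_rpow_le q (hc j))
    refine ⟨fun y z hyz => hR.expectedCost_le_of_forall_poissonRatio_le hyz hA
      (fractionalBell_ne_top q), fun ε _ y z hyz => hR.expectedCost_le_mul_ipValue hyz hA
      (fractionalBell_ne_top q), ?_⟩
    -- No nonemptiness is assumed here; for empty `P` the right side is `∞` because `A_q` is not 0.
    rcases Q.P.eq_empty_or_nonempty with hP | hP
    · rw [BooleanConvexProgram.lpValue_eq_top_of_P_eq_empty hP,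
        ENNReal.mul_top (fractionalBell_ne_zero q)]
      exact le_top
    · exact hR.ipValue_le_mul_lpValue hP hA (fractionalBell_ne_top q)
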